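/- Let $q_0>0$, and consider the defocusing nonlocal (reverse-space-time) mKdV equation ($\sigma=1$) $$q_t(x,t)-6\,q(-x,-t)\,q(x,t)\,q_x(x,t)+q_{xxx}(x,t)=0,\qquad x,t\in\mathbb R,$$ for real $q$ with $\lim_{x\to\pm\infty}q(x,t)=q_\pm$, $|q_\pm|=q_0$, $q_+=\delta q_-$, $\delta=-1$, and $q(\cdot,t)-q_\pm\in L^1(\mathbb R^\pm)$ for every $t$. ("Solution" means classical solution.) Notation. For $z\neq0$ put $k(z)=\frac12\left(z-\frac{q_0^2}{z}\right)$, $\lambda(z)=\frac12\left(z+\frac{q_0^2}{z}\right)$, $\theta(x,t;z)=\lambda\,[x+(4k^2-2q_0^2)t]$, $$X(x,t;z)=\begin{pmatrix} ik& q(x,t)\\ q(-x,-t)&-ik\end{pmatrix},\qquad E_\pm(z)=\begin{pmatrix}1& iq_\pm/z\\ iq_\pm/z&1\end{pmatrix}.$$ Let $\Sigma=\{z\ne0:\lambda(z)\in\mathbb R\}=(\mathbb R\setminus\{0\})\cup\{|z|=q_0\}$, $\Sigma^0=\Sigma\setminus\{\pm iq_0\}$, $D_+=\{z\neq 0:\operatorname{Im}\lambda(z)>0\}$.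 For $z\in\Sigma^0$ the Jost solutions $\Phi_\pm(x,t;z)$ are the $2\times2$ matrix solutions of $\Phi_x=X\Phi$ with $\Phi_\pm=E_\pm e^{i\theta\sigma_3}+o(1)$ as $x\to\pm\infty$, and the scattering matrix $S=(s_{ij})$ is given by $\Phi_+=\Phi_-S$. The reflection coefficients are $\varrho=s_{21}/s_{11}$ and $\tilde\varrho=s_{12}/s_{22}$. The potential $q$ is reflectionless at time $t$ if, for every $z\in\Sigma^0$, $S(z)$ is defined, $s_{11}(z)\ne 0\neq s_{22}(z)$ and $\varrho(z)=\tilde\varrho(z)=0$. For $z\in D_+$, $s_{11}(z)=\mathrm{Wr}(\Phi_{+1},\Phi_{-2})/(1+q_0^2/z^2)$, where the columns $\Phi_{+1},\Phi_{-2}$ solve $\Phi_x=X\Phi$ with $\Phi_{+1}e^{-i\theta}\to E_{+1}$ as $x\to+\infty$ and $\Phi_{-2}e^{i\theta}\to E_{-2}$ as $x\to-\infty$. The theta condition for zeros $z_1,\dots,z_{N_1}$ and $iw_1,\dots,iw_{N_2}$ ($w_m\in\mathbb R$) of $s_{11}$ in $D_+$ is $$\left(\prod_{n=1}^{N_1}\frac{|z_n|^4}{q_0^4}\prod_{m=1}^{N_2}(-\delta\sigma)\frac{w_m^2}{q_0^2}\right)\exp\left(\frac1{2\pi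 i}\int_\Sigma\frac{\log[1+s_{12}(\zeta)s_{21}(\zeta)]}{\zeta}\,d\zeta\right)=\delta,$$ where $\Sigma$ is oriented with $D_+$ on its left and $\log$ is the principal branch. Claim (for $\sigma=1$, $\delta=-1$). 1. For every such solution $q$, $s_{11}$ (computed at $t=0$) has no zero in $D_+\cap i\mathbb R$, that is, $N_2=0$. 2. For every matrix function $S$ whose reflection coefficients are defined and vanish on $\Sigma^0$, and for all $N_1\ge 0$ and $z_1,\dots,z_{N_1}\in\mathbb C$, the theta condition with $N_2=0$ is equivalent to $\prod_{n=1}^{N_1}|z_n|^4/q_0^4=-1$. 3. This equation has no solution, for any $N_1\ge0$ and any $z_1,\dots,z_{N_1}\in\mathbb C$. 4. There are no reflectionless potentials: no solution $q$ as above is reflectionless at any time $t$. -/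

import Mathlib

open Complex Filter Topology MeasureTheory

namespace NonlocalMKdV

noncomputable section

/-- `q` is a (classical, real) solution of the nonlocal (reverse-space-time) mKdV equation
`q_t - 6 σ q(-x,-t) q q_x + q_xxx = 0` with the non-zero boundary conditions
`q(x,t) → q_±` as `x → ±∞`, where `q_- = qm`, `q_+ = δ q_-`, `|q_±| = q₀ > 0`, and with
`q(·,t) - q_±` integrable on the half-lines `ℝ^±`. -/
structure IsNZBCSolution (σ δ q₀ qm : ℝ) (q : ℝ → ℝ → ℝ) : Prop where
  pos : 0 < q₀
  abs_qm : |qm| = q₀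
  smooth_x : ∀ t, ContDiff ℝ 3 (fun x => q x t)
  diff_t : ∀ x, Differentiable ℝ (fun t => q x t)
  pde : ∀ x t, deriv (fun s => q x s) t
      - 6 * σ * q (-x) (-t) * q x t * deriv (fun y => q y t) x
      + iteratedDeriv 3 (fun y => q y t) x = 0
  lim_right : ∀ t, Tendsto (fun x => q x t) atTop (𝓝 (δ * qm))
  lim_left : ∀ t, Tendsto (fun x => q x t) atBot (𝓝 qm)
  int_right : ∀ t, IntegrableOn (fun x => q x t - δ * qm) (Set.Ici 0)
  int_left : ∀ t, IntegrableOn (fun x => q x t - qm) (Set.Iic 0)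

/-- The spectral parameter `k(z) = (z + δσ q₀²/z)/2` in the uniformization variable `z`. -/
def kOf (σ δ q₀ : ℝ) (z : ℂ) : ℂ := (z + δ * σ * q₀ ^ 2 / z) / 2

/-- `λ(z) = (z - δσ q₀²/z)/2`, so that `λ² = k² - δσ q₀²` and `k + λ = z`. -/
def lamOf (σ δ q₀ : ℝ) (z : ℂ) : ℂ := (z - δ * σ * q₀ ^ 2 / z) / 2

/-- The phase `θ(x,t;z) = λ [x + (4k² + 2σδ q₀²) t]`. -/
def theta (σ δ q₀ : ℝ) (x t : ℝ) (z : ℂ) : ℂ :=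
  lamOf σ δ q₀ z * (x + (4 * kOf σ δ q₀ z ^ 2 + 2 * σ * δ * q₀ ^ 2) * t)

/-- The matrix `X = i k σ₃ + Q` of the space part `Φ_x = X Φ` of the Lax pair. -/
def laxX (σ δ q₀ : ℝ) (q : ℝ → ℝ → ℝ) (x t : ℝ) (z : ℂ) : Matrix (Fin 2) (Fin 2) ℂ :=
  !![I * kOf σ δ q₀ z, (q x t : ℂ);
     ((σ * q (-x) (-t) : ℝ) : ℂ), -(I * kOf σ δ q₀ z)]

/-- The matrix `E_±(z)` of background eigenvectors; `qpm` stands for `q_+` or `q_-`. -/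
def bgE (σ δ qpm : ℝ) (z : ℂ) : Matrix (Fin 2) (Fin 2) ℂ :=
  !![1, I * qpm / z; -(δ * σ * (I * qpm / z)), 1]

/-- The diagonal matrix `exp(i θ σ₃)`. -/
def expTheta (σ δ q₀ : ℝ) (x t : ℝ) (z : ℂ) : Matrix (Fin 2) (Fin 2) ℂ :=
  !![exp (I * theta σ δ q₀ x t z), 0; 0, exp (-(I * theta σ δ q₀ x t z))]

/-- The continuous spectrum without the branch points, `Σ⁰`: `λ(z)` is real and non-zero. For
`δσ = 1` this is `ℝ \ {0, ±q₀}`, for `δσ = -1` it is `(ℝ \ {0}) ∪ {|z| = q₀}` without `±i q₀`. -/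
def contSpectrum (σ δ q₀ : ℝ) : Set ℂ :=
  {z | z ≠ 0 ∧ (lamOf σ δ q₀ z).im = 0 ∧ lamOf σ δ q₀ z ≠ 0}

/-- The region `D_+ = {Im λ(z) > 0}`; for `δσ = 1` this is the upper half-plane, for `δσ = -1`
it is `{(|z| - q₀) Im z > 0}` (without `z = 0`). -/
def dPlus (σ δ q₀ : ℝ) : Set ℂ := {z | z ≠ 0 ∧ 0 < (lamOf σ δ q₀ z).im}

/-- `Φ` is, at time `t` and for `z` in the continuous spectrum, the Jost solution with
`Φ(x) = E(z) exp(iθσ₃) + o(1)` along the filter `F` (`F = atTop` with `qpm = q_+` for `Φ_+`,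
`F = atBot` with `qpm = q_-` for `Φ_-`). -/
def IsJost (σ δ q₀ qpm : ℝ) (F : Filter ℝ) (q : ℝ → ℝ → ℝ) (t : ℝ) (z : ℂ)
    (Φ : ℝ → Matrix (Fin 2) (Fin 2) ℂ) : Prop :=
  (∀ i j x, HasDerivAt (fun y => Φ y i j) ((laxX σ δ q₀ q x t z * Φ x) i j) x) ∧
  (∀ i j, Tendsto (fun x => Φ x i j - (bgE σ δ qpm z * expTheta σ δ q₀ x t z) i j) F (𝓝 0))

/-- `S` is the scattering matrix of `q` at time `t` and `z ∈ Σ⁰`: `Φ_+ = Φ_- S`. -/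
def IsScatteringMatrix (σ δ q₀ qm : ℝ) (q : ℝ → ℝ → ℝ) (t : ℝ) (z : ℂ)
    (S : Matrix (Fin 2) (Fin 2) ℂ) : Prop :=
  ∃ Φp Φm : ℝ → Matrix (Fin 2) (Fin 2) ℂ,
    IsJost σ δ q₀ (δ * qm) atTop q t z Φp ∧ IsJost σ δ q₀ qm atBot q t z Φm ∧
    ∀ x, Φp x = Φm x * S

/-- The reflection coefficient `ϱ = s₂₁ / s₁₁`. -/
def reflCoeff (S : Matrix (Fin 2) (Fin 2) ℂ) : ℂ := S 1 0 / S 0 0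

/-- The reflection coefficient `ϱ̃ = s₁₂ / s₂₂`. -/
def reflCoeffTilde (S : Matrix (Fin 2) (Fin 2) ℂ) : ℂ := S 0 1 / S 1 1

/-- The reflection coefficients are defined (no spectral singularity) and vanish. -/
def NoReflection (S : Matrix (Fin 2) (Fin 2) ℂ) : Prop :=
  S 0 0 ≠ 0 ∧ S 1 1 ≠ 0 ∧ reflCoeff S = 0 ∧ reflCoeffTilde S = 0

/-- `q` is reflectionless at time `t`: both reflection coefficients vanish identically. -/
def IsReflectionless (σ δ q₀ qm : ℝ) (q : ℝ → ℝ → ℝ) (t : ℝ) : Prop :=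
  ∀ z ∈ contSpectrum σ δ q₀, ∃ S, IsScatteringMatrix σ δ q₀ qm q t z S ∧ NoReflection S

/-- `a` is the value `s₁₁(z)`, `z ∈ D_+`, computed at time `t` from
`s₁₁ = Wr(Φ_{+1}, Φ_{-2}) / (1 - δσ q₀²/z²)`. For `z ∈ D_+` the columns `Φ_{+1}` and `Φ_{-2}` are
the solutions `u`, `v` of the space part of the Lax pair with `u e^{-iθ} → E_{+1}` at `+∞` and
`v e^{iθ} → E_{-2}` at `-∞`. -/
def IsS11 (σ δ q₀ qm : ℝ) (q : ℝ → ℝ → ℝ) (t : ℝ) (z : ℂ) (a : ℂ) : Prop :=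
  ∃ u v : ℝ → Fin 2 → ℂ,
    (∀ i x, HasDerivAt (fun y => u y i) ((laxX σ δ q₀ q x t z).mulVec (u x) i) x) ∧
    (∀ i x, HasDerivAt (fun y => v y i) ((laxX σ δ q₀ q x t z).mulVec (v x) i) x) ∧
    (∀ i, Tendsto (fun x => u x i * exp (-(I * theta σ δ q₀ x t z))) atTop
      (𝓝 (bgE σ δ (δ * qm) z i 0))) ∧
    (∀ i, Tendsto (fun x => v x i * exp (I * theta σ δ q₀ x t z)) atBot
      (𝓝 (bgE σ δ qm z i 1))) ∧
    ∀ x, a = (u x 0 * v x 1 - u x 1 * v x 0) / (1 - δ * σ * q₀ ^ 2 / z ^ 2)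

/-- The integral over the continuous spectrum `Σ`, oriented with `D_+` on the left. For
`δσ = 1`, `Σ` is the real line from left to right. For `δσ = -1`, it consists of
`(-∞, -q₀)` and `(q₀, ∞)` from left to right, `(-q₀, q₀)` from right to left, and the upper
(clockwise) and lower (counterclockwise) halves of the circle `|z| = q₀`. -/
def contourInt (σ δ q₀ : ℝ) (f : ℂ → ℂ) : ℂ :=
  if δ * σ = 1 then ∫ x : ℝ, f x
  else (∫ x in Set.Iio (-q₀), f (x : ℂ)) + (∫ x in Set.Ioi q₀, f (x : ℂ))
    - (∫ x in (-q₀)..q₀, f (x : ℂ))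
    - (∫ φ in (0 : ℝ)..Real.pi, f (q₀ * exp (I * φ)) * (I * q₀ * exp (I * φ)))
    + (∫ φ in Real.pi..(2 * Real.pi), f (q₀ * exp (I * φ)) * (I * q₀ * exp (I * φ)))

/-- The theta condition for the zeros `z_n` (`Re z_n > 0`) and `i w_m` of `s₁₁` in `D_+` and the
scattering matrix `S`:
`∏ |z_n|⁴/q₀⁴ · ∏ (-δσ) w_m²/q₀² · exp((2πi)⁻¹ ∫_Σ log(1 + s₁₂ s₂₁)/ζ dζ) = δ`. -/
def ThetaCondition (σ δ q₀ : ℝ) {N₁ N₂ : ℕ} (z : Fin N₁ → ℂ) (w : Fin N₂ → ℝ)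
    (S : ℂ → Matrix (Fin 2) (Fin 2) ℂ) : Prop :=
  (((∏ n, ‖z n‖ ^ 4 / q₀ ^ 4) * (∏ m, (-(δ * σ)) * (w m ^ 2 / q₀ ^ 2)) : ℝ) : ℂ)
    * exp (1 / (2 * Real.pi * I)
        * contourInt σ δ q₀ (fun ζ => log (1 + S ζ 0 1 * S ζ 1 0) / ζ)) = (δ : ℂ)

end

end NonlocalMKdV

/-!
The traceless Lax matrix makes the Wronskian of two solutions constant in `x`, so it can be read off
from their asymptotics at `±∞` (`wronskian_eq_of_tendsto`). Both spectral claims follow from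
comparing Wronskians of solutions with those of their images under a symmetry.

*No imaginary eigenvalues.* For `z = i w` and `t = 0` the Lax matrix is real and the reflection
`(u₁, u₂)(x) ↦ (u₂, -u₁)(-x)` maps solutions to solutions. If `u` decays at `+∞` and `v` at `-∞`,
then the Wronskian of `u` with its conjugate and the one of the reflection of `u` with `v` vanish.
If `Wr(u, v)` vanished too, these relations at `x = 0` would give `(u₁² + u₂²) v = 0` there with
`u(0)` a complex multiple of a real vector, hence `u(0) = 0` or `v(0) = 0`, which the uniqueness
theorem for linear systems excludes (`wronskian_ne_zero_of_reflection`).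

*No reflectionless potentials.* On the circle `|z| = q₀` the symmetries `z ↦ -z̄` and
`z ↦ -q₀²/z` coincide, and as `q₊ = -q₋` together they give `s₂₂ = -s̄₁₁`. With `s₁₂ = s₂₁ = 0` and
`det S = 1` this would be `|s₁₁|² = -1`. The point `z = q₀` suffices, where `k = 0` and the Lax
matrix is real: the Wronskian of the first Jost column `Φ_{±1}` with its own conjugate is
`-2 i q_±/q₀` (`IsJost.wronskian_conj`), whereas `s₂₁ = 0` means `Φ_{+1} = s₁₁ Φ_{-1}`.

The theta condition loses its exponential factor because the integrand vanishes on `Σ` outside the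
branch points `±i q₀`, and the remaining product is nonnegative.
-/

namespace NonlocalMKdV

/-! ### Wronskians of planar linear systems -/

/-- `u` solves the linear system `u' = A u`; the derivative is taken componentwise. -/
def SolvesSystem (A : ℝ → Matrix (Fin 2) (Fin 2) ℂ) (u : ℝ → Fin 2 → ℂ) : Prop :=
  ∀ i x, HasDerivAt (fun y => u y i) ((A x).mulVec (u x) i) x

/-- The Wronskian determinant `u₁ v₂ - u₂ v₁`. -/
def wronskian (u v : ℝ → Fin 2 → ℂ) (x : ℝ) : ℂ := u x 0 * v x 1 - u x 1 * v x 0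

lemma SolvesSystem.wronskian_const {A : ℝ → Matrix (Fin 2) (Fin 2) ℂ} {u v : ℝ → Fin 2 → ℂ}
    (hA : ∀ x, A x 1 1 = -A x 0 0) (hu : SolvesSystem A u) (hv : SolvesSystem A v) (x y : ℝ) :
    wronskian u v x = wronskian u v y := by
  have h : ∀ x, HasDerivAt (wronskian u v) 0 x := by
    intro x
    have h := ((hu 0 x).mul (hv 1 x)).sub ((hu 1 x).mul (hv 0 x))
    refine h.congr_deriv ?_
    simp only [Matrix.mulVec, dotProduct, Fin.sum_univ_two, hA]
    ring
  exact is_const_of_deriv_eq_zero (fun x => (h x).differentiableAt) (fun x => (h x).deriv) x y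

/-- The Wronskian from the asymptotics of the two solutions: `H` is the product of their growth
rates `1/E` and `1/G`. -/
lemma wronskian_eq_of_tendsto {A : ℝ → Matrix (Fin 2) (Fin 2) ℂ} {u v : ℝ → Fin 2 → ℂ}
    (hA : ∀ x, A x 1 1 = -A x 0 0) (hu : SolvesSystem A u) (hv : SolvesSystem A v)
    {F : Filter ℝ} [F.NeBot] {E G H : ℝ → ℂ} {α β : Fin 2 → ℂ} {c : ℂ}
    (hα : ∀ i, Tendsto (fun x => u x i * E x) F (𝓝 (α i)))
    (hβ : ∀ i, Tendsto (fun x => v x i * G x) F (𝓝 (β i)))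
    (hH : Tendsto H F (𝓝 c)) (hEGH : ∀ x, E x * G x * H x = 1) (x : ℝ) :
    wronskian u v x = (α 0 * β 1 - α 1 * β 0) * c := by
  have h := (((hα 0).mul (hβ 1)).sub ((hα 1).mul (hβ 0))).mul hH
  refine tendsto_nhds_unique (Tendsto.congr (fun y => ?_) h) tendsto_const_nhds |>.symm
  rw [hu.wronskian_const hA hv x y, wronskian]
  linear_combination (u y 0 * v y 1 - u y 1 * v y 0) * hEGH y

lemma SolvesSystem.conj {A : ℝ → Matrix (Fin 2) (Fin 2) ℂ} {u : ℝ → Fin 2 → ℂ}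
    (hA : ∀ x i j, starRingEnd ℂ (A x i j) = A x i j) (hu : SolvesSystem A u) :
    SolvesSystem A (fun x i => starRingEnd ℂ (u x i)) := by
  intro i x
  refine (hu i x).star.congr_deriv ?_
  simp only [Matrix.mulVec, dotProduct, Fin.sum_univ_two, star_add, star_mul']
  have h := hA x i
  simp only [starRingEnd_apply] at h ⊢
  rw [h, h]

/-- A solution of a linear system with continuous coefficients that vanishes at `0` vanishes
identically. -/
lemma SolvesSystem.eq_zero {A : ℝ → Matrix (Fin 2) (Fin 2) ℂ} {u : ℝ → Fin 2 → ℂ}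
    (hA : Continuous A) (hu : SolvesSystem A u) (h0 : u 0 = 0) (x : ℝ) : u x = 0 := by
  let L : Matrix (Fin 2) (Fin 2) ℂ →ₗ[ℂ] ((Fin 2 → ℂ) →L[ℂ] (Fin 2 → ℂ)) :=
    LinearMap.toContinuousLinearMap.toLinearMap ∘ₗ Matrix.toLin'.toLinearMap
  have hL : ∀ M v, L M v = M.mulVec v := fun M v => rfl
  have hLA : Continuous fun x => ‖L (A x)‖₊ :=
    (L.continuous_of_finiteDimensional.comp hA).nnnorm
  obtain ⟨K, hK⟩ := (isCompact_Icc (a := -(|x| + 1)) (b := |x| + 1)).bddAbove_image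
    hLA.continuousOn
  have hx := abs_lt.1 (lt_add_one |x|)
  have hx0 : 0 < |x| + 1 := by positivity
  refine ODE_solution_unique_of_mem_Ioo (v := fun x v => L (A x) v) (s := fun _ => Set.univ)
    (g := 0) (K := K) (t₀ := 0) (a := -(|x| + 1)) (b := |x| + 1) ?_ ⟨by linarith, hx0⟩ ?_ ?_ h0
    (show x ∈ Set.Ioo _ _ from ⟨by linarith, hx.2⟩)
  · intro t ht
    exact ((L (A t)).lipschitz.weaken
      (hK (Set.mem_image_of_mem _ (Set.Ioo_subset_Icc_self ht)))).lipschitzOnWith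
  · exact fun t _ => ⟨hasDerivAt_pi.2 fun i => hu i t, trivial⟩
  · intro t _
    refine ⟨?_, trivial⟩
    simp

/-! ### The reflection symmetry and imaginary eigenvalues -/

lemma SolvesSystem.reflect {κ : ℝ} {a : ℝ → ℝ} {u : ℝ → Fin 2 → ℂ}
    (hu : SolvesSystem (fun x => !![((-κ : ℝ) : ℂ), (a x : ℂ); (a (-x) : ℂ), (κ : ℂ)]) u) :
    SolvesSystem (fun x => !![((-κ : ℝ) : ℂ), (a x : ℂ); (a (-x) : ℂ), (κ : ℂ)])
      (fun x => ![u (-x) 1, -u (-x) 0]) := by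
  have h : ∀ i x, HasDerivAt (fun y => u (-y) i) _ x := fun i x => by
    simpa [Function.comp_def] using (hu i (-x)).scomp x (hasDerivAt_neg x)
  intro i x
  fin_cases i
  · refine (h 1 x).congr_deriv ?_
    simp [Matrix.vecHead, Matrix.vecTail]
    ring
  · refine (h 0 x).neg.congr_deriv ?_
    simp [Matrix.vecHead, Matrix.vecTail]
    ring

/-- For a real system with reflection symmetry, a solution that decays at `+∞` and one that decays
at `-∞` are linearly independent. -/
lemma wronskian_ne_zero_of_reflection {κ ν : ℝ} (hν : 0 < ν) {a : ℝ → ℝ} (ha : Continuous a)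
    {u v : ℝ → Fin 2 → ℂ} {α β : Fin 2 → ℂ}
    (hu : SolvesSystem (fun x => !![((-κ : ℝ) : ℂ), (a x : ℂ); (a (-x) : ℂ), (κ : ℂ)]) u)
    (hv : SolvesSystem (fun x => !![((-κ : ℝ) : ℂ), (a x : ℂ); (a (-x) : ℂ), (κ : ℂ)]) v)
    (hα : ∀ i, Tendsto (fun x => u x i * (Real.exp (ν * x) : ℂ)) atTop (𝓝 (α i)))
    (hβ : ∀ i, Tendsto (fun x => v x i * (Real.exp (-(ν * x)) : ℂ)) atBot (𝓝 (β i)))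
    (hα0 : α ≠ 0) (hβ0 : β ≠ 0) : wronskian u v 0 ≠ 0 := by
  intro hW
  set A : ℝ → Matrix (Fin 2) (Fin 2) ℂ :=
    fun x => !![((-κ : ℝ) : ℂ), (a x : ℂ); (a (-x) : ℂ), (κ : ℂ)] with hA
  have htr : ∀ x, A x 1 1 = -A x 0 0 := fun x => by simp [hA]
  have hreal : ∀ x i j, starRingEnd ℂ (A x i j) = A x i j := fun x i j => by
    fin_cases i <;> fin_cases j <;> simp [hA]
  have hcont : Continuous A := by
    refine continuous_matrix fun i j => ?_
    fin_cases i <;> fin_cases j <;> simp [hA] <;> fun_prop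
  have hu0 : u 0 ≠ 0 := fun h => hα0 <| funext fun i => by
    refine tendsto_nhds_unique (hα i) ?_
    simp [hu.eq_zero hcont h]
  have hv0 : v 0 ≠ 0 := fun h => hβ0 <| funext fun i => by
    refine tendsto_nhds_unique (hβ i) ?_
    simp [hv.eq_zero hcont h]
  have hH : Tendsto (fun x : ℝ => ((Real.exp (-(2 * ν * x)) : ℝ) : ℂ)) atTop (𝓝 0) := by
    have h : Tendsto (fun x : ℝ => Real.exp (-(2 * ν * x))) atTop (𝓝 0) :=
      Real.tendsto_exp_neg_atTop_nhds_zero.comp (tendsto_id.const_mul_atTop (by positivity))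
    exact_mod_cast (continuous_ofReal.tendsto 0).comp h
  have hH' : Tendsto (fun x : ℝ => ((Real.exp (2 * ν * x) : ℝ) : ℂ)) atBot (𝓝 0) := by
    simpa [Function.comp_def] using hH.comp tendsto_neg_atBot_atTop
  have h1 := wronskian_eq_of_tendsto htr hu (hu.conj hreal) (β := fun i => starRingEnd ℂ (α i))
    (G := fun x => (Real.exp (ν * x) : ℂ)) hα (fun i => by
      simpa [Function.comp_def, ← ofReal_exp] using
        (continuous_conj.tendsto _).comp (hα i)) hH (fun x => by
      rw [← ofReal_mul, ← ofReal_mul, ← Real.exp_add, ← Real.exp_add]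
      ring_nf
      simp) 0
  have hα' : ∀ i, Tendsto (fun x => u (-x) i * (Real.exp (-(ν * x)) : ℂ)) atBot (𝓝 (α i)) :=
    fun i => by simpa [Function.comp_def] using (hα i).comp tendsto_neg_atBot_atTop
  have h2 := wronskian_eq_of_tendsto htr hu.reflect hv (α := ![α 1, -α 0])
    (E := fun x => (Real.exp (-(ν * x)) : ℂ)) (fun i => by
      fin_cases i
      · simpa using hα' 1
      · simpa using (hα' 0).neg) hβ hH' (fun x => by
      rw [← ofReal_mul, ← ofReal_mul, ← Real.exp_add, ← Real.exp_add]
      ring_nf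
      simp) 0
  simp only [wronskian, mul_zero, neg_zero, Matrix.cons_val_zero, Matrix.cons_val_one] at hW h1 h2
  have hs0 : (u 0 0 ^ 2 + u 0 1 ^ 2) * v 0 0 = 0 := by
    linear_combination (-u 0 1) * hW + u 0 0 * h2
  have hs1 : (u 0 0 ^ 2 + u 0 1 ^ 2) * v 0 1 = 0 := by
    linear_combination u 0 0 * hW + u 0 1 * h2
  have hs : u 0 0 ^ 2 + u 0 1 ^ 2 = 0 := by
    by_contra hne
    refine hv0 (funext fun i => ?_)
    fin_cases i
    · exact (mul_eq_zero.1 hs0).resolve_left hne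
    · exact (mul_eq_zero.1 hs1).resolve_left hne
  -- As `u 0` is a multiple of a real vector, `(u₁² + u₂²) ū₁ = u₁ (|u₁|² + |u₂|²)`.
  have hn : ((‖u 0 0‖ ^ 2 + ‖u 0 1‖ ^ 2 : ℝ) : ℂ) ≠ 0 := by
    intro h
    have h := ofReal_eq_zero.1 h
    refine hu0 (funext fun i => ?_)
    fin_cases i
    · exact norm_eq_zero.1 (pow_eq_zero_iff two_ne_zero |>.1 (by
        linarith [sq_nonneg ‖u 0 0‖, sq_nonneg ‖u 0 1‖] : ‖u 0 0‖ ^ 2 = 0))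
    · exact norm_eq_zero.1 (pow_eq_zero_iff two_ne_zero |>.1 (by
        linarith [sq_nonneg ‖u 0 0‖, sq_nonneg ‖u 0 1‖] : ‖u 0 1‖ ^ 2 = 0))
  have e0 := mul_conj' (u 0 0)
  have e1 := mul_conj' (u 0 1)
  push_cast at hn
  refine hu0 (funext fun i => ?_)
  fin_cases i
  · refine (mul_eq_zero.1 (?_ : _ * u 0 0 = 0)).resolve_left hn
    linear_combination (-u 0 0) * e0 - u 0 0 * e1 + starRingEnd ℂ (u 0 0) * hs + u 0 1 * h1
  · refine (mul_eq_zero.1 (?_ : _ * u 0 1 = 0)).resolve_left hn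
    linear_combination (-u 0 1) * e0 - u 0 1 * e1 + starRingEnd ℂ (u 0 1) * hs - u 0 0 * h1

lemma s11_ne_zero_of_imaginary {q₀ qm : ℝ} {q : ℝ → ℝ → ℝ} (hq : IsNZBCSolution 1 (-1) q₀ qm q)
    {w : ℝ} (hw : I * (w : ℂ) ∈ dPlus 1 (-1) q₀) {a : ℂ}
    (ha : IsS11 1 (-1) q₀ qm q 0 (I * (w : ℂ)) a) : a ≠ 0 := by
  obtain ⟨hw0, him⟩ := hw
  have hw0 : w ≠ 0 := by
    rintro rfl
    simp at hw0
  have hwc : (w : ℂ) ≠ 0 := ofReal_ne_zero.2 hw0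
  have hlam : lamOf 1 (-1) q₀ (I * w) = I * (((w - q₀ ^ 2 / w) / 2 : ℝ) : ℂ) := by
    simp only [lamOf]
    push_cast
    field_simp
    rw [I_sq]
    ring
  have hk : I * kOf 1 (-1) q₀ (I * w) = ((-((w + q₀ ^ 2 / w) / 2) : ℝ) : ℂ) := by
    simp only [kOf]
    push_cast
    field_simp
    rw [I_sq]
    ring
  have hν : 0 < (w - q₀ ^ 2 / w) / 2 := by
    rw [hlam] at him
    simpa only [I_mul_im, ofReal_re] using him
  set ν := (w - q₀ ^ 2 / w) / 2 with hν_def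
  have hθ : ∀ x : ℝ, I * theta 1 (-1) q₀ x 0 (I * w) = ((-(ν * x) : ℝ) : ℂ) := by
    intro x
    simp only [theta, hlam]
    push_cast
    linear_combination (ν * x : ℂ) * I_sq
  have hA : (fun x => laxX 1 (-1) q₀ q x 0 (I * w)) = fun x =>
      !![((-((w + q₀ ^ 2 / w) / 2) : ℝ) : ℂ), (q x 0 : ℂ); (q (-x) 0 : ℂ),
        (((w + q₀ ^ 2 / w) / 2 : ℝ) : ℂ)] := by
    funext x
    simp only [laxX, hk]
    simp
  obtain ⟨u, v, hu, hv, hα, hβ, hW⟩ := ha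
  have hu : SolvesSystem (fun x => laxX 1 (-1) q₀ q x 0 (I * w)) u := hu
  have hv : SolvesSystem (fun x => laxX 1 (-1) q₀ q x 0 (I * w)) v := hv
  rw [hA] at hu hv
  have hne := wronskian_ne_zero_of_reflection (a := fun x => q x 0) hν (hq.smooth_x 0).continuous
    hu hv (fun i => by simpa only [hθ, ← ofReal_neg, neg_neg, ← ofReal_exp] using hα i)
    (fun i => by simpa only [hθ, ← ofReal_exp] using hβ i)
    (fun h => by simpa [bgE] using congrFun h 0) (fun h => by simpa [bgE] using congrFun h 1)
  rw [hW 0]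
  refine div_ne_zero hne fun h => ?_
  -- `1 + q₀²/z² = 1 - q₀²/w²` is `2 ν/w`.
  have h' : ((2 * ν / w : ℝ) : ℂ) = 0 := by
    rw [← h, hν_def]
    push_cast
    field_simp
    rw [I_sq]
    ring
  exact div_ne_zero (mul_ne_zero two_ne_zero hν.ne') hw0 (ofReal_eq_zero.1 h')

/-! ### The theta condition without reflection -/

lemma lamOf_defocusing (q₀ : ℝ) (z : ℂ) : lamOf 1 (-1) q₀ z = (z + q₀ ^ 2 / z) / 2 := by
  simp [lamOf, neg_div]

lemma ofReal_mem_contSpectrum (q₀ : ℝ) {x : ℝ} (hx : x ≠ 0) :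
    (x : ℂ) ∈ contSpectrum 1 (-1) q₀ := by
  have h : lamOf 1 (-1) q₀ x = (((x + q₀ ^ 2 / x) / 2 : ℝ) : ℂ) := by
    rw [lamOf_defocusing]
    push_cast
    rfl
  refine ⟨ofReal_ne_zero.2 hx, by rw [h, ofReal_im], ?_⟩
  rw [h, ofReal_ne_zero]
  have : x + q₀ ^ 2 / x = (x ^ 2 + q₀ ^ 2) / x := by field_simp
  rw [this]
  have : 0 < x ^ 2 + q₀ ^ 2 := by positivity
  positivity

lemma circle_mem_contSpectrum {q₀ : ℝ} (hq₀ : 0 < q₀) {φ : ℝ} (hφ : Real.cos φ ≠ 0) :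
    q₀ * exp (I * φ) ∈ contSpectrum 1 (-1) q₀ := by
  have hqc : (q₀ : ℂ) ≠ 0 := ofReal_ne_zero.2 hq₀.ne'
  have h : lamOf 1 (-1) q₀ (q₀ * exp (I * φ)) = ((q₀ * Real.cos φ : ℝ) : ℂ) := by
    rw [lamOf_defocusing]
    push_cast
    rw [Complex.cos, neg_mul, exp_neg, mul_comm (φ : ℂ) I]
    have := exp_ne_zero (I * φ)
    field_simp
  refine ⟨mul_ne_zero hqc (exp_ne_zero _), by rw [h, ofReal_im], ?_⟩
  rw [h, ofReal_ne_zero]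
  exact mul_ne_zero hq₀.ne' hφ

/-- The contour integral does not see the branch points `±i q₀` and the point `0`. -/
lemma contourInt_eq_zero {q₀ : ℝ} (hq₀ : 0 < q₀) {f : ℂ → ℂ}
    (hf : ∀ ζ ∈ contSpectrum 1 (-1) q₀, f ζ = 0) : contourInt 1 (-1) q₀ f = 0 := by
  have hr : (fun x : ℝ => f x) =ᵐ[volume] 0 := by
    filter_upwards [(Set.countable_singleton (0 : ℝ)).ae_notMem volume] with x hx
    exact hf _ (ofReal_mem_contSpectrum q₀ hx)
  have hcos : {φ : ℝ | Real.cos φ = 0}.Countable := by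
    refine (Set.countable_range fun k : ℤ => (2 * k + 1) * Real.pi / 2).mono fun φ hφ => ?_
    obtain ⟨k, hk⟩ := Real.cos_eq_zero_iff.1 hφ
    exact ⟨k, hk.symm⟩
  have hc : ∀ a b : ℝ,
      ∫ φ in a..b, f (q₀ * exp (I * φ)) * (I * q₀ * exp (I * φ)) = 0 := fun a b => by
    refine intervalIntegral.integral_zero_ae ?_
    filter_upwards [hcos.ae_notMem volume] with φ hφ _
    rw [hf _ (circle_mem_contSpectrum hq₀ hφ), zero_mul]
  have hset : ∀ s : Set ℝ, ∫ x in s, f x = 0 := fun s =>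
    integral_eq_zero_of_ae (ae_restrict_of_ae hr)
  have hi : ∫ x in (-q₀)..q₀, f x = 0 := by
    refine intervalIntegral.integral_zero_ae ?_
    filter_upwards [hr] with x hx _ using hx
  rw [contourInt, if_neg (by norm_num), hset, hset, hi, hc, hc]
  simp

lemma NoReflection.apply_one_zero {S : Matrix (Fin 2) (Fin 2) ℂ} (hS : NoReflection S) :
    S 1 0 = 0 :=
  (div_eq_zero_iff.1 hS.2.2.1).resolve_right hS.1

lemma thetaCondition_iff_of_noReflection {q₀ : ℝ} (hq₀ : 0 < q₀)
    {S : ℂ → Matrix (Fin 2) (Fin 2) ℂ} (hS : ∀ ζ ∈ contSpectrum 1 (-1) q₀, NoReflection (S ζ))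
    {N₁ : ℕ} (z : Fin N₁ → ℂ) :
    ThetaCondition 1 (-1) q₀ z (Fin.elim0 : Fin 0 → ℝ) S ↔
      ∏ n, ‖z n‖ ^ 4 / q₀ ^ 4 = (-1 : ℝ) := by
  have h : contourInt 1 (-1) q₀ (fun ζ => log (1 + S ζ 0 1 * S ζ 1 0) / ζ) = 0 :=
    contourInt_eq_zero hq₀ fun ζ hζ => by simp [(hS ζ hζ).apply_one_zero]
  rw [ThetaCondition, h, mul_zero, exp_zero, mul_one, ofReal_inj,
    Fin.prod_univ_zero, mul_one]

/-! ### The Jost columns at `z = q₀` -/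

/-- At `z = q₀` the Lax matrix is real and the first Jost column and its conjugate are
linearly independent, with a Wronskian given by the boundary value. -/
lemma IsJost.wronskian_conj {q₀ qpm t : ℝ} (hq₀ : 0 < q₀) {F : Filter ℝ} [F.NeBot]
    {q : ℝ → ℝ → ℝ} {Φ : ℝ → Matrix (Fin 2) (Fin 2) ℂ}
    (h : IsJost 1 (-1) q₀ qpm F q t q₀ Φ) (x : ℝ) :
    wronskian (fun y i => Φ y i 0) (fun y i => starRingEnd ℂ (Φ y i 0)) x
      = -2 * I * qpm / q₀ := by
  have hqc : (q₀ : ℂ) ≠ 0 := ofReal_ne_zero.2 hq₀.ne'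
  obtain ⟨hd, hlim⟩ := h
  have hk : kOf 1 (-1) q₀ q₀ = 0 := by
    simp only [kOf]
    push_cast
    field_simp
    ring
  have hlam : lamOf 1 (-1) q₀ q₀ = q₀ := by
    rw [lamOf_defocusing]
    field_simp
    ring
  set s : ℝ → ℝ := fun x => q₀ * (x - 2 * q₀ ^ 2 * t) with hs
  have hθ : ∀ x : ℝ, theta 1 (-1) q₀ x t q₀ = s x := by
    intro x
    simp only [theta, hk, hlam, hs]
    push_cast
    ring
  have htr : ∀ x, laxX 1 (-1) q₀ q x t q₀ 1 1 = -laxX 1 (-1) q₀ q x t q₀ 0 0 := fun x => by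
    simp [laxX]
  have hreal : ∀ x i j, starRingEnd ℂ (laxX 1 (-1) q₀ q x t q₀ i j) = laxX 1 (-1) q₀ q x t q₀ i j :=
    fun x i j => by fin_cases i <;> fin_cases j <;> simp [laxX, hk]
  have hu : SolvesSystem (fun x => laxX 1 (-1) q₀ q x t q₀) (fun y i => Φ y i 0) :=
    fun i x => hd i 0 x
  have hα : ∀ i, Tendsto (fun x => Φ x i 0 * exp (-(I * s x))) F
      (𝓝 (bgE 1 (-1) qpm q₀ i 0)) := by
    intro i
    have h0 := (hlim i 0).norm
    rw [norm_zero] at h0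
    refine tendsto_iff_norm_sub_tendsto_zero.2 (h0.congr fun x => ?_)
    have hE : (bgE 1 (-1) qpm q₀ * expTheta 1 (-1) q₀ x t q₀) i 0
        = bgE 1 (-1) qpm q₀ i 0 * exp (I * s x) := by
      simp [Matrix.mul_apply, Fin.sum_univ_two, expTheta, hθ]
    have hn : ‖exp (-(I * s x))‖ = 1 := by
      rw [norm_exp]
      simp
    rw [hE, ← mul_one ‖_ - _‖, ← hn, ← norm_mul, sub_mul, mul_assoc (bgE _ _ _ _ _ _),
      ← exp_add, add_neg_cancel, exp_zero, mul_one]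
  have hβ : ∀ i, Tendsto (fun x => starRingEnd ℂ (Φ x i 0) * exp (I * s x)) F
      (𝓝 (starRingEnd ℂ (bgE 1 (-1) qpm q₀ i 0))) := fun i => by
    simpa [Function.comp_def, ← exp_conj] using (continuous_conj.tendsto _).comp (hα i)
  rw [wronskian_eq_of_tendsto htr hu (hu.conj hreal) hα hβ (H := fun _ => 1) tendsto_const_nhds
    (fun x => by rw [← exp_add]; simp) x]
  simp [bgE]
  ring

lemma not_isReflectionless {q₀ qm t : ℝ} {q : ℝ → ℝ → ℝ}
    (hq : IsNZBCSolution 1 (-1) q₀ qm q) : ¬ IsReflectionless 1 (-1) q₀ qm q t := by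
  intro h
  have hq₀ := hq.pos
  have hqc : (q₀ : ℂ) ≠ 0 := ofReal_ne_zero.2 hq₀.ne'
  have hqm : (qm : ℂ) ≠ 0 := by
    refine ofReal_ne_zero.2 fun h0 => hq₀.ne ?_
    rw [← hq.abs_qm, h0, abs_zero]
  obtain ⟨S, ⟨Φp, Φm, hp, hm, hS⟩, hR⟩ := h q₀ (ofReal_mem_contSpectrum q₀ hq₀.ne')
  have hcol : ∀ i, Φp 0 i 0 = S 0 0 * Φm 0 i 0 := fun i => by
    rw [hS 0, Matrix.mul_apply, Fin.sum_univ_two, hR.apply_one_zero]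
    ring
  have h1 := hp.wronskian_conj hq₀ 0
  have h2 := hm.wronskian_conj hq₀ 0
  simp only [wronskian, hcol, map_mul] at h1 h2
  have h3 : (-2 * I * qm / q₀) * (S 0 0 * starRingEnd ℂ (S 0 0) + 1) = 0 := by
    push_cast at h1
    linear_combination h1 - S 0 0 * starRingEnd ℂ (S 0 0) * h2
  have hc : (-2 * I * qm / q₀ : ℂ) ≠ 0 :=
    div_ne_zero (mul_ne_zero (mul_ne_zero (by norm_num) I_ne_zero) hqm) hqc
  have h4 := (mul_eq_zero.1 h3).resolve_left hc
  rw [mul_conj'] at h4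
  have h5 : ‖S 0 0‖ ^ 2 + 1 = 0 := by exact_mod_cast h4
  exact absurd h5 (by positivity)

end NonlocalMKdV

open NonlocalMKdV in
theorem mainTheorem11 (q₀ : ℝ) (hq₀ : 0 < q₀) :
    -- no imaginary discrete spectrum, i.e. `N₂ = 0`
    (∀ (qm : ℝ) (q : ℝ → ℝ → ℝ), IsNZBCSolution 1 (-1) q₀ qm q →
      ∀ w : ℝ, Complex.I * (w : ℂ) ∈ dPlus 1 (-1) q₀ →
        ∀ a : ℂ, IsS11 1 (-1) q₀ qm q 0 (Complex.I * (w : ℂ)) a → a ≠ 0) ∧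
    -- the theta condition without reflection and with `N₂ = 0`
    (∀ S : ℂ → Matrix (Fin 2) (Fin 2) ℂ,
      (∀ ζ ∈ contSpectrum 1 (-1) q₀, NoReflection (S ζ)) →
      ∀ (N₁ : ℕ) (z : Fin N₁ → ℂ),
        ThetaCondition 1 (-1) q₀ z (Fin.elim0 : Fin 0 → ℝ) S ↔
          ∏ n, ‖z n‖ ^ 4 / q₀ ^ 4 = (-1 : ℝ)) ∧
    -- which is impossible
    (∀ (N₁ : ℕ) (z : Fin N₁ → ℂ), ∏ n, ‖z n‖ ^ 4 / q₀ ^ 4 ≠ (-1 : ℝ)) ∧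
    -- there are no reflectionless potentials
    (¬ ∃ (qm : ℝ) (q : ℝ → ℝ → ℝ) (t : ℝ),
      IsNZBCSolution 1 (-1) q₀ qm q ∧ IsReflectionless 1 (-1) q₀ qm q t) := by
  refine ⟨fun qm q hq w hw a ha => s11_ne_zero_of_imaginary hq hw ha,
    fun S hS N₁ z => thetaCondition_iff_of_noReflection hq₀ hS z, fun N₁ z h => ?_, ?_⟩
  · have : 0 ≤ ∏ n, ‖z n‖ ^ 4 / q₀ ^ 4 := Finset.prod_nonneg fun n _ => by positivity
    linarith
  · rintro ⟨qm, q, t, hq, hr⟩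
    exact not_isReflectionless hq hr
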